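/- Let $d\ge 1$, let $\Omega\subset\mathbb R^d$ be a bounded open set (no regularity of $\partial\Omega$ is needed), and let $\mathcal A(\Omega)$ be the family of open subsets of $\Omega$. **Admissible energies.** Let $\mathcal F:L^1(\Omega)\times\mathcal A(\Omega)\to[0,+\infty]$ and $X:=\{\phi\in L^1(\Omega):\mathcal F(\phi;\Omega)<+\infty\}$. We call $\mathcal F$ *admissible* if * (Ad1) for every $A\in\mathcal A(\Omega)$ the map $\phi\mapsto\mathcal F(\phi;A)$ is lower semicontinuous on $L^1(\Omega)$; * (Ad2) for every $\phi\in X$ the map $\mathcal F(\phi;\cdot)$ is the restriction to $\mathcal A(\Omega)$ of a (finite) Radon measure on $\Omega$, denoted by $\mathcal F^\phi$; * (Ad3) for every $\phi\in X$, every $A\in\mathcal A(\Omega)$ with $\mathcal F(\phi;A)=0$, every nonempty open $U\subset\subset A$ (that is, $\overline U$ is a compact subset of $A$) and every $\varepsilon>0$ there is $\overline\phi\in X$ with $\overline\phi=\phi$ a.e. on $\Omega\setminus U$, $\|\overline\phi-\phi\|_{L^1}\le\varepsilon$, $\mathcal F^{\overline\phi}(\partial U)=0$ and $0<\mathcal F^{\overline\phi}(A)=\mathcal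 F^{\overline\phi}(U)<\varepsilon$; * (Ad4) $\mathcal F$ is *purely lower semicontinuous*: for every $\phi\in X$ and every $f\in L^1(\Omega,\mathcal F^\phi)$ with $f\ge1$ $\mathcal F^\phi$-a.e. there is a sequence $(\phi_n)\subset X$ with $\phi_n\to\phi$ in $L^1(\Omega)$ and $\mathcal F^{\phi_n}\rightharpoonup^* f\,\mathcal F^\phi$, i.e. $\int_\Omega g\,d\mathcal F^{\phi_n}\to\int_\Omega g f\,d\mathcal F^{\phi}$ for all $g\in C_0(\Omega)$. **Total variation.** For $\phi\in L^1(\Omega)$ and $U\in\mathcal A(\Omega)$ let $$V(\phi;U):=\sup\Big\{\int_\Omega\phi\,\operatorname{div}\xi\,dx:\ \xi\in C^1_c(U;\mathbb R^d),\ |\xi|\le1\Big\}\in[0,+\infty],$$ let $BV(\Omega):=\{\phi\in L^1(\Omega):V(\phi;\Omega)<+\infty\}$, and let $|D\phi|$ be the Borel measure on $\Omega$ with $|D\phi|(B)=\inf\{V(\phi;U):B\subset U\in\mathcal A(\Omega)\}$; it is finite exactly when $\phi\in BV(\Omega)$. **Proposition.** Let $\rho\in C^1(\Omega)\cap C^0(\overline\Omega)$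 with $\rho>0$ on $\overline\Omega$ (hence $0<\min_{\overline\Omega}\rho\le\max_{\overline\Omega}\rho<+\infty$ if $\Omega\neq\emptyset$), and let $$\mathcal F(\phi;A):=\int_A\rho^2\,d|D\phi|\in[0,+\infty],\qquad \phi\in L^1(\Omega),\ A\in\mathcal A(\Omega).$$ Then $X=BV(\Omega)$ and $\mathcal F$ is an admissible energy. In particular, $\mathcal F$ is purely lower semicontinuous. -/

import Mathlib

open MeasureTheory Filter Topology Set
open scoped ENNReal

noncomputable section

/-- The Euclidean space `ℝ^d`. -/
abbrev Euc (d : ℕ) : Type := EuclideanSpace ℝ (Fin d)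

/-- The Banach space `L¹(Ω)` of real functions on `Ω`, with respect to Lebesgue measure. -/
abbrev LOne {d : ℕ} (Ω : Set (Euc d)) : Type := Lp ℝ 1 (volume.restrict Ω)

/-! ### Admissible energies

A functional `F : L¹(Ω) × {open subsets of Ω} → [0, ∞]` is represented by
`F : LOne Ω → Set (Euc d) → ℝ≥0∞`; only its values on open subsets of `Ω` are ever used. -/

/-- The domain `X = {φ ∈ L¹(Ω) | F(φ; Ω) < ∞}`. -/
def energyDomain {d : ℕ} (Ω : Set (Euc d)) (F : LOne Ω → Set (Euc d) → ℝ≥0∞) : Set (LOne Ω) :=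
  {φ | F φ Ω < ∞}

/-- `μ` is a Borel measure on `Ω` (carried by `Ω`) whose restriction to the open subsets of `Ω`
is `F(φ; ·)`. For `φ` in the domain of `F` such a `μ` has finite mass `F(φ; Ω)`, so it is a
finite Radon measure on `Ω`, and it is uniquely determined: it is the measure `F^φ`. -/
structure IsEnergyMeasure {d : ℕ} (Ω : Set (Euc d)) (F : LOne Ω → Set (Euc d) → ℝ≥0∞)
    (φ : LOne Ω) (μ : Measure (Euc d)) : Prop where
  compl_eq_zero : μ Ωᶜ = 0
  apply_open : ∀ A : Set (Euc d), IsOpen A → A ⊆ Ω → μ A = F φ A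

/-- Weak* convergence of finite measures on `Ω`, tested with `C₀(Ω)`. For a bounded open set `Ω`
the elements of `C₀(Ω)`, extended by zero, are exactly the continuous functions on `ℝ^d` that
vanish outside `Ω`. -/
def WeakStarTendsto {d : ℕ} (Ω : Set (Euc d)) (μs : ℕ → Measure (Euc d))
    (μ : Measure (Euc d)) : Prop :=
  ∀ g : Euc d → ℝ, Continuous g → (∀ x ∉ Ω, g x = 0) →
    Tendsto (fun n => ∫ x, g x ∂(μs n)) atTop (𝓝 (∫ x, g x ∂μ))

/-- Pure lower semicontinuity: for all `φ ∈ X` and `f ∈ L¹(Ω, F^φ)` with `f ≥ 1` almost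
everywhere there are `φ_n ∈ X` with `φ_n → φ` in `L¹` and `F^{φ_n} ⇀* f F^φ`. -/
def IsPurelyLSC {d : ℕ} (Ω : Set (Euc d)) (F : LOne Ω → Set (Euc d) → ℝ≥0∞) : Prop :=
  ∀ φ ∈ energyDomain Ω F, ∀ μ : Measure (Euc d), IsEnergyMeasure Ω F φ μ →
    ∀ f : Euc d → ℝ, Integrable f μ → (∀ᵐ x ∂μ, 1 ≤ f x) →
      ∃ (φs : ℕ → LOne Ω) (μs : ℕ → Measure (Euc d)),
        (∀ n, φs n ∈ energyDomain Ω F) ∧ (∀ n, IsEnergyMeasure Ω F (φs n) (μs n)) ∧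
        Tendsto φs atTop (𝓝 φ) ∧
        WeakStarTendsto Ω μs (μ.withDensity fun x => ENNReal.ofReal (f x))

/-- Admissible energies. In `nondegenerate` the relation `U ⊂⊂ A` means that `closure U` is a
compact subset of `A`; the open set `U` has to be nonempty, since `0 < F^ψ(U)` is required. -/
structure IsAdmissible {d : ℕ} (Ω : Set (Euc d)) (F : LOne Ω → Set (Euc d) → ℝ≥0∞) : Prop where
  lowerSemicontinuous : ∀ A : Set (Euc d), IsOpen A → A ⊆ Ω →
    LowerSemicontinuous fun φ : LOne Ω => F φ A
  exists_measure : ∀ φ ∈ energyDomain Ω F, ∃ μ : Measure (Euc d), IsEnergyMeasure Ω F φ μ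
  nondegenerate : ∀ φ ∈ energyDomain Ω F, ∀ A : Set (Euc d), IsOpen A → A ⊆ Ω → F φ A = 0 →
    ∀ U : Set (Euc d), IsOpen U → U.Nonempty → IsCompact (closure U) → closure U ⊆ A →
      ∀ ε : ℝ, 0 < ε →
        ∃ ψ ∈ energyDomain Ω F, ∃ ν : Measure (Euc d), IsEnergyMeasure Ω F ψ ν ∧
          (∀ᵐ x ∂(volume.restrict (Ω \ U)), ψ x = φ x) ∧
          ‖ψ - φ‖ ≤ ε ∧ ν (frontier U) = 0 ∧
          0 < ν A ∧ ν A = ν U ∧ ν U < ENNReal.ofReal ε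
  purelyLSC : IsPurelyLSC Ω F

/-! ### Functions of bounded variation and the total variation measure -/

/-- The divergence `∑ i, ∂ᵢ ξᵢ` of a vector field. -/
def divergence {d : ℕ} (ξ : Euc d → Euc d) (x : Euc d) : ℝ :=
  ∑ i : Fin d, (fderiv ℝ ξ x (EuclideanSpace.single i 1)) i

/-- The vector fields `ξ ∈ C¹_c(U; ℝ^d)` with `|ξ| ≤ 1`. -/
def testFields {d : ℕ} (U : Set (Euc d)) : Set (Euc d → Euc d) :=
  {ξ | ContDiff ℝ 1 ξ ∧ HasCompactSupport ξ ∧ tsupport ξ ⊆ U ∧ ∀ x, ‖ξ x‖ ≤ 1}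

/-- The variation `V(φ; U) = sup {∫ φ div ξ | ξ ∈ C¹_c(U; ℝ^d), |ξ| ≤ 1}` of `φ ∈ L¹(Ω)` in an
open set `U ⊆ Ω`. -/
def variation {d : ℕ} {Ω : Set (Euc d)} (φ : LOne Ω) (U : Set (Euc d)) : ℝ≥0∞ :=
  ⨆ ξ ∈ testFields U, ENNReal.ofReal (∫ x in Ω, φ x * divergence ξ x)

/-- `φ ∈ BV(Ω)`. -/
def IsBV {d : ℕ} {Ω : Set (Euc d)} (φ : LOne Ω) : Prop := variation φ Ω < ∞

lemma testFields_empty {d : ℕ} {ξ : Euc d → Euc d} (h : ξ ∈ testFields (∅ : Set (Euc d))) :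
    ξ = 0 := by
  have h1 := h.2.2.1
  rw [Set.subset_empty_iff, tsupport_eq_empty_iff] at h1
  exact h1

lemma divergence_zero {d : ℕ} (x : Euc d) : divergence (0 : Euc d → Euc d) x = 0 := by
  simp [divergence]

lemma variation_empty {d : ℕ} {Ω : Set (Euc d)} (φ : LOne Ω) : variation φ ∅ = 0 := by
  unfold variation
  simp only [ENNReal.iSup_eq_zero]
  intro ξ h
  rw [testFields_empty h]
  simp [divergence_zero]

lemma zero_mem_testFields {d : ℕ} (U : Set (Euc d)) : (0 : Euc d → Euc d) ∈ testFields U := by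
  refine ⟨contDiff_const, HasCompactSupport.zero, ?_, by simp⟩
  simp [tsupport]

lemma testFields_mono {d : ℕ} {U W : Set (Euc d)} (h : U ⊆ W) : testFields U ⊆ testFields W :=
  fun _ hξ => ⟨hξ.1, hξ.2.1, hξ.2.2.1.trans h, hξ.2.2.2⟩

lemma continuous_divergence {d : ℕ} {ξ : Euc d → Euc d} (h : ContDiff ℝ 1 ξ) :
    Continuous (divergence ξ) := by
  have h1 : Continuous (fderiv ℝ ξ) := h.continuous_fderiv (by norm_num)
  unfold divergence
  fun_prop

lemma hasCompactSupport_divergence {d : ℕ} {ξ : Euc d → Euc d} (h : HasCompactSupport ξ) :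
    HasCompactSupport (divergence ξ) := by
  refine (h.fderiv ℝ).mono ?_
  intro x hx hx'
  exact hx (by simp [divergence, hx'])

lemma integrable_mul_divergence {d : ℕ} {Ω : Set (Euc d)} (φ : LOne Ω) {ξ : Euc d → Euc d}
    (h : ContDiff ℝ 1 ξ) (hc : HasCompactSupport ξ) :
    Integrable (fun x => φ x * divergence ξ x) (volume.restrict Ω) := by
  obtain ⟨C, hC⟩ := (hasCompactSupport_divergence hc).exists_bound_of_continuous
    (continuous_divergence h)
  exact (L1.integrable_coeFn φ).mul_bdd (c := C)
    (continuous_divergence h).aestronglyMeasurable (Eventually.of_forall hC)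

lemma variation_add_le {d : ℕ} {Ω : Set (Euc d)} (φ : LOne Ω) {U V W : Set (Euc d)}
    (hUV : Disjoint U V) (hU : U ⊆ W) (hV : V ⊆ W) :
    variation φ U + variation φ V ≤ variation φ W := by
  refine ENNReal.biSup_add_biSup_le' ⟨0, zero_mem_testFields U⟩ ⟨0, zero_mem_testFields V⟩ ?_
  intro ξ hξ η hη
  have key : ∀ ζ ∈ testFields W,
      ENNReal.ofReal (∫ x in Ω, φ x * divergence ζ x) ≤ variation φ W := fun ζ hζ =>
    le_iSup₂ (f := fun ζ (_ : ζ ∈ testFields W) =>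
      ENNReal.ofReal (∫ x in Ω, φ x * divergence ζ x)) ζ hζ
  rcases le_total (∫ x in Ω, φ x * divergence ξ x) 0 with h | h
  · rw [ENNReal.ofReal_of_nonpos h, zero_add]
    exact key η (testFields_mono hV hη)
  rcases le_total (∫ x in Ω, φ x * divergence η x) 0 with h' | h'
  · rw [ENNReal.ofReal_of_nonpos h', add_zero]
    exact key ξ (testFields_mono hU hξ)
  rw [← ENNReal.ofReal_add h h', ← integral_add (integrable_mul_divergence φ hξ.1 hξ.2.1)
    (integrable_mul_divergence φ hη.1 hη.2.1)]
  have hsum : ξ + η ∈ testFields W := by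
    refine ⟨hξ.1.add hη.1, hξ.2.1.add hη.2.1, ?_, ?_⟩
    · exact (tsupport_add ξ η).trans
        (union_subset (hξ.2.2.1.trans hU) (hη.2.2.1.trans hV))
    · intro x
      by_cases hx : x ∈ U
      · have : η x = 0 := image_eq_zero_of_notMem_tsupport
          fun hm => Set.disjoint_left.1 hUV hx (hη.2.2.1 hm)
        simpa [this] using hξ.2.2.2 x
      · have : ξ x = 0 := image_eq_zero_of_notMem_tsupport fun hm => hx (hξ.2.2.1 hm)
        simpa [this] using hη.2.2.2 x
  refine le_trans (le_of_eq ?_) (key _ hsum)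
  congr 2
  ext x
  have h1 : DifferentiableAt ℝ ξ x := (hξ.1.differentiable (by norm_num)) x
  have h2 : DifferentiableAt ℝ η x := (hη.1.differentiable (by norm_num)) x
  simp only [divergence, fderiv_add h1 h2, add_apply, PiLp.add_apply,
    Finset.sum_add_distrib, mul_add]

/-- The outer measure generated by the variation on open sets: its value at `B` is the infimum of
`∑ n, V(φ; U n ∩ Ω)` over the countable covers of `B` by open sets `U n`. As the variation is
monotone and countably subadditive on open sets, this is `inf {V(φ; U ∩ Ω) | U ⊇ B open}`. -/
def variationOuter {d : ℕ} {Ω : Set (Euc d)} (φ : LOne Ω) : OuterMeasure (Euc d) :=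
  inducedOuterMeasure (fun U (_ : IsOpen U) => variation φ (U ∩ Ω)) isOpen_empty
    (by rw [Set.empty_inter]; exact variation_empty φ)

lemma variationOuter_isMetric {d : ℕ} {Ω : Set (Euc d)} (φ : LOne Ω) :
    (variationOuter φ).IsMetric := by
  rintro s t ⟨r, hr, hst⟩
  refine le_antisymm (measure_union_le s t) ?_
  set S : Set (Euc d) := {y | Metric.infEDist y s < r / 2} with hS
  set T : Set (Euc d) := {y | Metric.infEDist y t < r / 2} with hT
  have hSo : IsOpen S := isOpen_lt Metric.continuous_infEDist continuous_const
  have hTo : IsOpen T := isOpen_lt Metric.continuous_infEDist continuous_const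
  have hr2 : (0 : ℝ≥0∞) < r / 2 := ENNReal.half_pos (by exact_mod_cast hr)
  have hsS : s ⊆ S := fun x hx => by
    change Metric.infEDist x s < r / 2
    rwa [Metric.infEDist_zero_of_mem hx]
  have htT : t ⊆ T := fun x hx => by
    change Metric.infEDist x t < r / 2
    rwa [Metric.infEDist_zero_of_mem hx]
  have hST : Disjoint S T := by
    rw [Set.disjoint_left]
    intro y hy1 hy2
    obtain ⟨x, hx, hxy⟩ := Metric.infEDist_lt_iff.1 hy1
    obtain ⟨z, hz, hzy⟩ := Metric.infEDist_lt_iff.1 hy2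
    have h1 := hst x hx z hz
    have h2 : edist x z < r := calc
      edist x z ≤ edist y x + edist y z := edist_triangle_left x z y
      _ < r / 2 + r / 2 := ENNReal.add_lt_add hxy hzy
      _ = r := ENNReal.add_halves _
    exact absurd h1 (not_le.2 h2)
  have hle : ∀ U : Set (Euc d), IsOpen U → variationOuter φ U ≤ variation φ (U ∩ Ω) :=
    fun U hU => by
      unfold variationOuter inducedOuterMeasure
      refine (OuterMeasure.ofFunction_le U).trans (le_of_eq ?_)
      exact extend_eq (fun U (_ : IsOpen U) => variation φ (U ∩ Ω)) hU
  conv_rhs => rw [variationOuter, inducedOuterMeasure,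
    OuterMeasure.ofFunction_eq_iInf_mem _ _ (P := IsOpen) (fun U hU => extend_eq_top _ hU)]
  refine le_iInf fun U => le_iInf fun hUo => le_iInf fun hcov => ?_
  have hs' : s ⊆ ⋃ n, U n ∩ S := by
    rw [← Set.iUnion_inter]
    exact subset_inter (subset_union_left.trans hcov) hsS
  have ht' : t ⊆ ⋃ n, U n ∩ T := by
    rw [← Set.iUnion_inter]
    exact subset_inter (subset_union_right.trans hcov) htT
  calc variationOuter φ s + variationOuter φ t
      ≤ (∑' n, variationOuter φ (U n ∩ S)) + ∑' n, variationOuter φ (U n ∩ T) :=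
        add_le_add ((measure_mono hs').trans (measure_iUnion_le _))
          ((measure_mono ht').trans (measure_iUnion_le _))
    _ = ∑' n, (variationOuter φ (U n ∩ S) + variationOuter φ (U n ∩ T)) :=
        ENNReal.tsum_add.symm
    _ ≤ ∑' n, extend (fun U (_ : IsOpen U) => variation φ (U ∩ Ω)) (U n) := by
        refine ENNReal.tsum_le_tsum fun n => ?_
        rw [extend_eq _ (hUo n)]
        refine (add_le_add (hle _ ((hUo n).inter hSo)) (hle _ ((hUo n).inter hTo))).trans ?_
        refine variation_add_le φ ?_ ?_ ?_
        · exact hST.mono (fun x hx => hx.1.2) (fun x hx => hx.1.2)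
        · exact fun x hx => ⟨hx.1.1, hx.2⟩
        · exact fun x hx => ⟨hx.1.1, hx.2⟩

/-- The total variation measure `|Dφ|` of `φ ∈ L¹(Ω)`: the Borel measure on `Ω` with
`|Dφ|(U) = V(φ; U)` for every open set `U ⊆ Ω`. It is finite if and only if `φ ∈ BV(Ω)`. -/
def totalVariationMeasure {d : ℕ} {Ω : Set (Euc d)} (φ : LOne Ω) : Measure (Euc d) :=
  ((variationOuter φ).toMeasure (by
    rw [BorelSpace.measurable_eq (α := Euc d)]
    exact (variationOuter_isMetric φ).borel_le_caratheodory)).restrict Ω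

/-- The weighted total variation `F(φ; A) = ∫_A ρ² d|Dφ|`. -/
def weightedTV {d : ℕ} (Ω : Set (Euc d)) (ρ : Euc d → ℝ) (φ : LOne Ω) (A : Set (Euc d)) : ℝ≥0∞ :=
  ∫⁻ x in A, ENNReal.ofReal (ρ x ^ 2) ∂(totalVariationMeasure φ)

end

noncomputable section

/-! On open sets `variation` is monotone and countably subadditive, so `totalVariationMeasure`
extends it. Since `m ≤ ρ² ≤ M` on `Ω` with `m > 0`, the weight does not affect finiteness, which
gives `X = BV(Ω)`; the energy measure is `ρ² |Dφ|`.

Lower semicontinuity: by the layer cake formula the energy is an integral over `t` of variations on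
the open sets `{x ∈ A | t < ρ x ^ 2}`. Each variation is a supremum of continuous linear
functionals, and Fatou's lemma passes this through the integral.

The other two axioms rest on `exists_concentrated_perturbation`. A bump in a ball of radius `r`,
scaled to variation `c`, has `L¹` norm at most `c * r`, so variation can be created at negligible
`L¹` cost. Placed around a non-atom of `|Dφ|`, it hardly interacts with the variation already there.
One such bump gives nondegeneracy.

For pure lower semicontinuity put `ν = (f - 1)|Dφ|`. Cover `Ω` by finitely many `δ`-balls and place
in each one bump carrying the share of `ν` in that ball (`exists_perturbation_of_cover`). As `δ → 0`
this yields `|Dφ_n| ⇀* |Dφ| + ν = f |Dφ|`. The weight is then absorbed into the test function,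
because `g ρ²` is again in `C₀(Ω)`. -/

/-! ### The variation on open sets and the measure `|Dφ|`. -/

lemma ofReal_integral_le_variation {d : ℕ} {Ω U : Set (Euc d)} (φ : LOne Ω) {ξ : Euc d → Euc d}
    (hξ : ξ ∈ testFields U) :
    ENNReal.ofReal (∫ x in Ω, φ x * divergence ξ x) ≤ variation φ U :=
  le_iSup₂ (f := fun ζ (_ : ζ ∈ testFields U) =>
    ENNReal.ofReal (∫ x in Ω, φ x * divergence ζ x)) ξ hξ

lemma variation_mono {d : ℕ} {Ω U W : Set (Euc d)} (φ : LOne Ω) (h : U ⊆ W) :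
    variation φ U ≤ variation φ W :=
  iSup₂_le fun _ hξ => ofReal_integral_le_variation φ (testFields_mono h hξ)

lemma divergence_sum {d : ℕ} {ι : Type*} (s : Finset ι) {ξ : ι → Euc d → Euc d}
    (h : ∀ i ∈ s, ContDiff ℝ 1 (ξ i)) (x : Euc d) :
    divergence (fun y => ∑ i ∈ s, ξ i y) x = ∑ i ∈ s, divergence (ξ i) x := by
  have h1 : ∀ i ∈ s, DifferentiableAt ℝ (ξ i) x :=
    fun i hi => ((h i hi).differentiable (by norm_num)) x
  simp only [divergence]
  rw [fderiv_fun_sum h1, Finset.sum_comm]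
  refine Finset.sum_congr rfl fun j _ => ?_
  rw [sum_apply, WithLp.ofLp_sum, Finset.sum_apply]

lemma divergence_const_smul {d : ℕ} {ξ : Euc d → Euc d} (c : ℝ) (h : ContDiff ℝ 1 ξ) (x : Euc d) :
    divergence (fun y => c • ξ y) x = c * divergence ξ x := by
  have h1 : DifferentiableAt ℝ ξ x := (h.differentiable (by norm_num)) x
  simp only [divergence]
  rw [fderiv_fun_const_smul h1, Finset.mul_sum]
  rfl

lemma smul_mem_testFields {d : ℕ} {U W : Set (Euc d)} {χ : Euc d → ℝ} {ξ : Euc d → Euc d}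
    (hξ : ξ ∈ testFields W) (hχ : ContDiff ℝ 1 χ) (h1 : ∀ x, |χ x| ≤ 1)
    (hs : tsupport (fun x => χ x • ξ x) ⊆ U) : (fun x => χ x • ξ x) ∈ testFields U := by
  refine ⟨hχ.smul hξ.1, hξ.2.1.mono fun x hx hx' => hx ?_, hs, fun x => ?_⟩
  · simp [hx']
  · rw [norm_smul]
    exact mul_le_one₀ (h1 x) (norm_nonneg _) (hξ.2.2.2 x)

/-- The compact support of a test field meets only finitely many `U n` of a subcover. A partition of
unity cuts the field into pieces which remain admissible, since `0 ≤ p i ≤ 1`. -/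
lemma variation_iUnion_le {d : ℕ} {Ω : Set (Euc d)} (φ : LOne Ω) {U : ℕ → Set (Euc d)}
    (hU : ∀ n, IsOpen (U n)) : variation φ (⋃ n, U n) ≤ ∑' n, variation φ (U n) := by
  refine iSup₂_le fun ξ hξ => ?_
  obtain ⟨t, ht⟩ := IsCompact.elim_finite_subcover (show IsCompact (tsupport ξ) from hξ.2.1) U hU
    hξ.2.2.1
  obtain ⟨p, hp⟩ := SmoothPartitionOfUnity.exists_isSubordinate (modelWithCornersSelf ℝ (Euc d))
    (isClosed_tsupport ξ) (fun i : t => U i) (fun i => hU i) (by simpa [iUnion_subtype] using ht)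
  have hpC : ∀ i, ContDiff ℝ 1 (p i) := fun i => ((p i).contMDiff.contDiff).of_le (by
    exact_mod_cast le_top)
  set η : t → Euc d → Euc d := fun i x => p i x • ξ x with hη
  have hηt : ∀ i : t, η i ∈ testFields (U i) := fun i =>
    smul_mem_testFields hξ (hpC i)
      (fun x => by rw [abs_of_nonneg (p.nonneg i x)]; exact p.le_one i x)
      ((tsupport_smul_subset_left (p i) ξ).trans (hp i))
  have hsum : ξ = fun x => ∑ i, η i x := by
    ext1 x
    by_cases hx : x ∈ tsupport ξ
    · have := p.sum_eq_one hx
      rw [finsum_eq_sum_of_fintype] at this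
      simp only [hη]
      rw [← Finset.sum_smul, this, one_smul]
    · simp [hη, image_eq_zero_of_notMem_tsupport hx]
  have hint : ∫ x in Ω, φ x * divergence ξ x = ∑ i, ∫ x in Ω, φ x * divergence (η i) x := by
    rw [← integral_finsetSum _ fun i _ => integrable_mul_divergence φ (hηt i).1 (hηt i).2.1]
    congr 1
    ext1 x
    conv_lhs => rw [hsum]
    rw [divergence_sum _ fun i _ => (hηt i).1, Finset.mul_sum]
  rw [hint]
  calc ENNReal.ofReal (∑ i, ∫ x in Ω, φ x * divergence (η i) x)
      ≤ ∑ i, ENNReal.ofReal (∫ x in Ω, φ x * divergence (η i) x) :=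
        Finset.le_sum_of_subadditive _ ENNReal.ofReal_zero.le (fun _ _ => ENNReal.ofReal_add_le) _ _
    _ ≤ ∑ i : t, variation φ (U i) :=
        Finset.sum_le_sum fun i _ => ofReal_integral_le_variation φ (hηt i)
    _ = ∑ n ∈ t, variation φ (U n) := Finset.sum_coe_sort t fun n => variation φ (U n)
    _ ≤ ∑' n, variation φ (U n) := ENNReal.sum_le_tsum t

lemma variationOuter_apply_open {d : ℕ} {Ω U : Set (Euc d)} (hΩ : IsOpen Ω) (φ : LOne Ω)
    (hU : IsOpen U) : variationOuter φ U = variation φ (U ∩ Ω) := by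
  refine inducedOuterMeasure_eq' (P := IsOpen)
    (m := fun U _ => variation φ (U ∩ Ω)) (fun f hf => isOpen_iUnion hf) ?_ ?_ hU
  · intro f hf
    rw [iUnion_inter]
    exact variation_iUnion_le φ fun n => (hf n).inter hΩ
  · exact fun s t _ _ h => variation_mono φ (inter_subset_inter_left _ h)

lemma totalVariationMeasure_apply_open {d : ℕ} {Ω U : Set (Euc d)} (hΩ : IsOpen Ω) (φ : LOne Ω)
    (hU : IsOpen U) : totalVariationMeasure φ U = variation φ (U ∩ Ω) := by
  rw [totalVariationMeasure, Measure.restrict_apply hU.measurableSet,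
    toMeasure_apply _ _ (hU.inter hΩ).measurableSet, variationOuter_apply_open hΩ φ (hU.inter hΩ),
    inter_assoc, inter_self]

lemma totalVariationMeasure_compl {d : ℕ} {Ω : Set (Euc d)} (hΩ : IsOpen Ω) (φ : LOne Ω) :
    totalVariationMeasure φ Ωᶜ = 0 := by
  rw [totalVariationMeasure, Measure.restrict_apply hΩ.measurableSet.compl]
  simp

lemma totalVariationMeasure_univ {d : ℕ} {Ω : Set (Euc d)} (hΩ : IsOpen Ω) (φ : LOne Ω) :
    totalVariationMeasure φ univ = variation φ Ω := by
  rw [totalVariationMeasure_apply_open hΩ φ isOpen_univ, univ_inter]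

lemma IsBV.isFiniteMeasure {d : ℕ} {Ω : Set (Euc d)} (hΩ : IsOpen Ω) {φ : LOne Ω} (h : IsBV φ) :
    IsFiniteMeasure (totalVariationMeasure φ) :=
  ⟨by rw [totalVariationMeasure_univ hΩ]; exact h⟩

/-! ### Dependence of the variation on the function. -/

lemma variation_add_le_add {d : ℕ} {Ω : Set (Euc d)} (φ ψ : LOne Ω) (U : Set (Euc d)) :
    variation (φ + ψ) U ≤ variation φ U + variation ψ U := by
  refine iSup₂_le fun ξ hξ => ?_
  have h : ∫ x in Ω, (φ + ψ) x * divergence ξ x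
      = (∫ x in Ω, φ x * divergence ξ x) + ∫ x in Ω, ψ x * divergence ξ x := by
    rw [← integral_add (integrable_mul_divergence φ hξ.1 hξ.2.1)
      (integrable_mul_divergence ψ hξ.1 hξ.2.1)]
    refine integral_congr_ae ?_
    filter_upwards [Lp.coeFn_add φ ψ] with x hx
    rw [hx, Pi.add_apply, add_mul]
  rw [h]
  exact ENNReal.ofReal_add_le.trans (add_le_add (ofReal_integral_le_variation φ hξ)
    (ofReal_integral_le_variation ψ hξ))

lemma variation_smul_le {d : ℕ} {Ω : Set (Euc d)} (c : ℝ) (φ : LOne Ω) (U : Set (Euc d)) :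
    variation (c • φ) U ≤ ENNReal.ofReal |c| * variation φ U := by
  refine iSup₂_le fun ξ hξ => ?_
  -- The sign of `c` is moved onto the test field; for `c = 0` this is the zero field.
  have hmem : (fun y => (SignType.sign c : ℝ) • ξ y) ∈ testFields U := by
    refine smul_mem_testFields hξ contDiff_const (fun _ => ?_)
      ((tsupport_smul_subset_right (fun _ => (SignType.sign c : ℝ)) ξ).trans hξ.2.2.1)
    rcases lt_trichotomy c 0 with h | h | h <;> simp [h]
  have h : ∫ x in Ω, (c • φ) x * divergence ξ x
      = |c| * ∫ x in Ω, φ x * divergence (fun y => (SignType.sign c : ℝ) • ξ y) x := by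
    rw [← integral_const_mul]
    refine integral_congr_ae ?_
    filter_upwards [Lp.coeFn_smul c φ] with x hx
    rw [hx, divergence_const_smul _ hξ.1, Pi.smul_apply, smul_eq_mul]
    conv_lhs => rw [← abs_mul_sign c]
    ring
  rw [h, ENNReal.ofReal_mul (abs_nonneg c)]
  gcongr
  exact ofReal_integral_le_variation φ hmem

lemma variation_smul {d : ℕ} {Ω : Set (Euc d)} {c : ℝ} (hc : 0 ≤ c) (φ : LOne Ω)
    (U : Set (Euc d)) : variation (c • φ) U = ENNReal.ofReal c * variation φ U := by
  rcases hc.eq_or_lt with rfl | h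
  · refine le_antisymm ((variation_smul_le 0 φ U).trans (by simp)) (by simp)
  refine le_antisymm ((variation_smul_le c φ U).trans (by rw [abs_of_pos h])) ?_
  have h1 := variation_smul_le c⁻¹ (c • φ) U
  rw [inv_smul_smul₀ h.ne', abs_of_pos (inv_pos.2 h)] at h1
  calc ENNReal.ofReal c * variation φ U
      ≤ ENNReal.ofReal c * (ENNReal.ofReal c⁻¹ * variation (c • φ) U) := by gcongr
    _ = variation (c • φ) U := by
        rw [← mul_assoc, ← ENNReal.ofReal_mul h.le, mul_inv_cancel₀ h.ne', ENNReal.ofReal_one,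
          one_mul]

lemma variation_neg_le {d : ℕ} {Ω : Set (Euc d)} (φ : LOne Ω) (U : Set (Euc d)) :
    variation (-φ) U ≤ variation φ U := by
  simpa using variation_smul_le (-1) φ U

lemma variation_congr {d : ℕ} {Ω U : Set (Euc d)} {φ ψ : LOne Ω}
    (h : ∀ᵐ x ∂(volume.restrict Ω), x ∈ U → φ x = ψ x) : variation φ U = variation ψ U := by
  unfold variation
  refine iSup_congr fun ξ => iSup_congr fun hξ => ?_
  congr 1
  refine integral_congr_ae ?_
  filter_upwards [h] with x hx
  by_cases hxU : x ∈ U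
  · rw [hx hxU]
  · have : x ∉ tsupport (fderiv ℝ ξ) :=
      fun h' => hxU (hξ.2.2.1 (tsupport_fderiv_subset ℝ h'))
    simp [divergence, image_eq_zero_of_notMem_tsupport this]

/-! ### Lower semicontinuity. -/

lemma lowerSemicontinuous_variation {d : ℕ} {Ω : Set (Euc d)} (U : Set (Euc d)) :
    LowerSemicontinuous fun φ : LOne Ω => variation φ U := by
  refine lowerSemicontinuous_biSup fun ξ hξ => ?_
  refine (ENNReal.continuous_ofReal.comp ?_).lowerSemicontinuous
  obtain ⟨C, hC⟩ := (hasCompactSupport_divergence hξ.2.1).exists_bound_of_continuous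
    (continuous_divergence hξ.1)
  have hC0 : 0 ≤ C := (norm_nonneg _).trans (hC 0)
  -- Each functional in the supremum is Lipschitz, with constant a bound for the divergence of the
  -- test field.
  refine (LipschitzWith.of_dist_le_mul (K := C.toNNReal) fun φ ψ => ?_).continuous
  rw [Real.coe_toNNReal _ hC0, Real.dist_eq, ← integral_sub
    (integrable_mul_divergence φ hξ.1 hξ.2.1) (integrable_mul_divergence ψ hξ.1 hξ.2.1),
    dist_eq_norm, L1.norm_eq_integral_norm, ← integral_const_mul, ← Real.norm_eq_abs]
  refine norm_integral_le_of_norm_le ((L1.integrable_coeFn (φ - ψ)).norm.const_mul C) ?_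
  filter_upwards [Lp.coeFn_sub φ ψ] with x hx
  rw [hx, Pi.sub_apply, ← sub_mul, norm_mul, mul_comm]
  gcongr
  exact hC x

lemma lowerSemicontinuous_lintegral {α β : Type*} [TopologicalSpace α] [FirstCountableTopology α]
    [MeasurableSpace β] {μ : Measure β} {f : α → β → ℝ≥0∞} (hm : ∀ a, Measurable (f a))
    (hf : ∀ b, LowerSemicontinuous fun a => f a b) :
    LowerSemicontinuous fun a => ∫⁻ b, f a b ∂μ := by
  rw [lowerSemicontinuous_iff_le_liminf]
  intro a
  calc ∫⁻ b, f a b ∂μ ≤ ∫⁻ b, liminf (fun a' => f a' b) (𝓝 a) ∂μ :=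
        lintegral_mono fun b => (hf b).le_liminf a
    _ ≤ _ := lintegral_liminf_le hm

/-- Layer cake formula. The superlevel sets of the continuous weight are open, so only the variation
on open sets enters and its semicontinuity can be used for each `t`. -/
lemma weightedTV_eq_lintegral_variation {d : ℕ} {Ω A : Set (Euc d)} {ρ : Euc d → ℝ}
    (hΩ : IsOpen Ω) (hρ : ContinuousOn ρ Ω) (hA : IsOpen A) (hAΩ : A ⊆ Ω) (φ : LOne Ω) :
    weightedTV Ω ρ φ A = ∫⁻ t in Ioi (0 : ℝ), variation φ {x ∈ A | t < ρ x ^ 2} := by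
  have hc : ContinuousOn (fun x => ρ x ^ 2) A := (hρ.mono hAΩ).pow 2
  rw [weightedTV, lintegral_eq_lintegral_meas_lt _ (Eventually.of_forall fun x => sq_nonneg (ρ x))
    (hc.aemeasurable hA.measurableSet)]
  refine lintegral_congr fun t => ?_
  have ho : IsOpen {x ∈ A | t < ρ x ^ 2} := hc.isOpen_inter_preimage hA isOpen_Ioi
  rw [Measure.restrict_apply' hA.measurableSet, inter_comm]
  change totalVariationMeasure φ {x ∈ A | t < ρ x ^ 2} = _
  rw [totalVariationMeasure_apply_open hΩ φ ho,
    inter_eq_left.2 ((sep_subset _ _).trans hAΩ)]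

lemma lowerSemicontinuous_weightedTV {d : ℕ} {Ω A : Set (Euc d)} {ρ : Euc d → ℝ}
    (hΩ : IsOpen Ω) (hρ : ContinuousOn ρ Ω) (hA : IsOpen A) (hAΩ : A ⊆ Ω) :
    LowerSemicontinuous fun φ : LOne Ω => weightedTV Ω ρ φ A := by
  simp only [weightedTV_eq_lintegral_variation hΩ hρ hA hAΩ]
  refine lowerSemicontinuous_lintegral (fun φ => Antitone.measurable fun s t hst => ?_)
    fun t => lowerSemicontinuous_variation _
  exact variation_mono φ fun x hx => ⟨hx.1, hst.trans_lt hx.2⟩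

/-! ### Bumps with prescribed variation. -/

/-- Integration by parts in each coordinate, then `|ξ i| ≤ 1`. The bound does not depend on `ξ`, so
`C¹` functions with compact support have finite variation. -/
lemma integral_mul_divergence_le {d : ℕ} {h : Euc d → ℝ} (hC : ContDiff ℝ 1 h)
    (hs : HasCompactSupport h) {ξ : Euc d → Euc d} {U : Set (Euc d)} (hξ : ξ ∈ testFields U) :
    ∫ x, h x * divergence ξ x ≤ ∑ i : Fin d, ∫ x, ‖fderiv ℝ h x (EuclideanSpace.single i 1)‖ := by
  have hdh : ∀ v : Euc d, Continuous fun x => fderiv ℝ h x v := fun v =>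
    (hC.continuous_fderiv (by norm_num)).clm_apply continuous_const
  have hdhs : ∀ v : Euc d, HasCompactSupport fun x => fderiv ℝ h x v := fun v =>
    hs.fderiv_apply ℝ v
  have hξi : ∀ i : Fin d, ContDiff ℝ 1 fun x => ξ x i := fun i =>
    (EuclideanSpace.proj (𝕜 := ℝ) i : Euc d →L[ℝ] ℝ).contDiff.comp hξ.1
  have hfd : ∀ (i : Fin d) (x v : Euc d), (fderiv ℝ ξ x v) i = fderiv ℝ (fun y => ξ y i) x v := by
    intro i x v
    have h1 : HasFDerivAt ξ (fderiv ℝ ξ x) x :=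
      ((hξ.1.differentiable (by norm_num)) x).hasFDerivAt
    have h2 := (EuclideanSpace.proj (𝕜 := ℝ) i : Euc d →L[ℝ] ℝ).hasFDerivAt.comp x h1
    have h3 : fderiv ℝ (fun y => ξ y i) x = _ := h2.fderiv
    rw [h3]
    rfl
  have hdξ : ∀ (i : Fin d) (v : Euc d), Continuous fun x => fderiv ℝ (fun y => ξ y i) x v :=
    fun i v => ((hξi i).continuous_fderiv (by norm_num)).clm_apply continuous_const
  have hint : ∀ (i : Fin d) (v : Euc d),
      Integrable (fun x => h x * fderiv ℝ (fun y => ξ y i) x v) := fun i v =>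
    (hC.continuous.mul (hdξ i v)).integrable_of_hasCompactSupport hs.mul_right
  have hint' : ∀ (i : Fin d) (v : Euc d), Integrable (fun x => fderiv ℝ h x v * ξ x i) :=
    fun i v => ((hdh v).mul (hξi i).continuous).integrable_of_hasCompactSupport
      (HasCompactSupport.mul_right (hdhs v))
  simp only [divergence, hfd, Finset.mul_sum]
  rw [integral_finsetSum _ fun i _ => hint i _]
  refine Finset.sum_le_sum fun i _ => ?_
  rw [integral_mul_fderiv_eq_neg_fderiv_mul_of_integrable (hint' i _) (hint i _)
    ((hC.continuous.mul (hξi i).continuous).integrable_of_hasCompactSupport hs.mul_right)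
    (fun x _ => (hC.differentiable (by norm_num)) x)
    (fun x _ => ((hξi i).differentiable (by norm_num)) x)]
  refine (neg_le_abs _).trans ?_
  rw [← Real.norm_eq_abs]
  refine norm_integral_le_of_norm_le
    (((hdh _).integrable_of_hasCompactSupport (hdhs _)).norm) (Eventually.of_forall fun x => ?_)
  rw [norm_mul]
  exact mul_le_of_le_one_right (norm_nonneg _) ((PiLp.norm_apply_le (ξ x) i).trans (hξ.2.2.2 x))

lemma integral_mul_divergence_eq {d : ℕ} {Ω : Set (Euc d)} {h : Euc d → ℝ}
    (hsub : tsupport h ⊆ Ω) {w : LOne Ω} (hw : w =ᵐ[volume.restrict Ω] h) (ξ : Euc d → Euc d) :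
    ∫ x in Ω, w x * divergence ξ x = ∫ x, h x * divergence ξ x := by
  have h1 : ∫ x in Ω, w x * divergence ξ x = ∫ x in Ω, h x * divergence ξ x := by
    refine integral_congr_ae ?_
    filter_upwards [hw] with x hx
    rw [hx]
  rw [h1]
  refine setIntegral_eq_integral_of_forall_compl_eq_zero fun x hx => ?_
  rw [image_eq_zero_of_notMem_tsupport fun hm => hx (hsub hm), zero_mul]

lemma isBV_of_contDiff {d : ℕ} {Ω : Set (Euc d)} {h : Euc d → ℝ} (hC : ContDiff ℝ 1 h)
    (hs : HasCompactSupport h) (hsub : tsupport h ⊆ Ω) {w : LOne Ω}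
    (hw : w =ᵐ[volume.restrict Ω] h) : IsBV w := by
  refine lt_of_le_of_lt (iSup₂_le fun ξ hξ => ?_) (ENNReal.ofReal_lt_top
    (r := ∑ i : Fin d, ∫ x, ‖fderiv ℝ h x (EuclideanSpace.single i 1)‖))
  rw [integral_mul_divergence_eq hsub hw]
  exact ENNReal.ofReal_le_ofReal (integral_mul_divergence_le hC hs hξ)

lemma divergence_smul_sub {d : ℕ} (c : ℝ) (x y : Euc d) :
    divergence (fun z => c • (z - x)) y = c * d := by
  have h : HasFDerivAt (fun z : Euc d => c • (z - x)) (c • ContinuousLinearMap.id ℝ (Euc d)) y :=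
    ((hasFDerivAt_id y).sub_const x).const_smul c
  simp [divergence, h.fderiv, mul_comm]

lemma divergence_congr {d : ℕ} {ξ η : Euc d → Euc d} {x : Euc d} (h : ξ =ᶠ[𝓝 x] η) :
    divergence ξ x = divergence η x := by
  simp only [divergence, h.fderiv_eq]

/-- A radial test field in a ball whose divergence is `d / r` in the concentric ball of half the
radius. -/
lemma exists_radial_testField {d : ℕ} (x : Euc d) {r : ℝ} (hr : 0 < r) :
    ∃ ξ ∈ testFields (Metric.ball x r), ∀ y ∈ Metric.ball x (r / 2),
      divergence ξ y = r⁻¹ * d := by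
  let χ : ContDiffBump x := ⟨r / 2, 3 * r / 4, by positivity, by linarith⟩
  have hsupp : tsupport χ ⊆ Metric.ball x r := by
    rw [χ.tsupport_eq]
    exact Metric.closedBall_subset_ball (by change 3 * r / 4 < r; linarith)
  refine ⟨fun y => χ y • (r⁻¹ • (y - x)), ⟨?_, ?_, ?_, fun y => ?_⟩, fun y hy => ?_⟩
  · exact (χ.contDiff (n := 1)).smul (by fun_prop)
  · refine χ.hasCompactSupport.mono fun y hy hy' => hy ?_
    simp [hy']
  · exact (tsupport_smul_subset_left χ _).trans hsupp
  · by_cases hy : y ∈ tsupport χ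
    · have h1 := hsupp hy
      rw [Metric.mem_ball, dist_eq_norm] at h1
      rw [norm_smul, norm_smul, norm_inv, Real.norm_of_nonneg hr.le, Real.norm_of_nonneg χ.nonneg]
      refine mul_le_one₀ χ.le_one (by positivity) ?_
      rw [inv_mul_le_one₀ hr]
      exact h1.le
    · simp [image_eq_zero_of_notMem_tsupport hy]
  · rw [← divergence_smul_sub r⁻¹ x y]
    refine divergence_congr ?_
    filter_upwards [χ.eventuallyEq_one_of_mem_ball hy] with z hz
    rw [hz, Pi.one_apply, one_smul]

/-- A bump in the ball `B(x, r)` with prescribed variation and small `L¹` norm. -/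
lemma exists_bump {d : ℕ} (hd : 1 ≤ d) {Ω : Set (Euc d)} {x : Euc d} {r : ℝ} (hr : 0 < r)
    (hball : Metric.ball x r ⊆ Ω) {c : ℝ} (hc : 0 ≤ c) :
    ∃ w : LOne Ω, IsBV w ∧
      (∀ᵐ y ∂(volume.restrict Ω), y ∉ Metric.closedBall x (r / 2) → w y = 0) ∧
      variation w (Metric.ball x r) = ENNReal.ofReal c ∧ ‖w‖ ≤ c * r := by
  -- The bump vanishes off `ball x (r / 2)`, where the radial test field has constant divergence.
  let h : ContDiffBump x := ⟨r / 4, r / 2, by positivity, by linarith⟩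
  have hL : MemLp h 1 (volume.restrict Ω) :=
    h.continuous.memLp_of_hasCompactSupport h.hasCompactSupport
  have hsub : tsupport h ⊆ Ω := by
    rw [h.tsupport_eq]
    exact (Metric.closedBall_subset_ball (by change r / 2 < r; linarith)).trans hball
  set w : LOne Ω := hL.toLp with hwdef
  have hw : w =ᵐ[volume.restrict Ω] h := hL.coeFn_toLp
  have hBV : IsBV w := isBV_of_contDiff h.contDiff h.hasCompactSupport hsub hw
  have hI : 0 < ∫ y, h y := h.integral_pos
  have hnorm : ‖w‖ = ∫ y, h y := by
    rw [L1.norm_eq_integral_norm]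
    have h1 : ∫ y in Ω, ‖w y‖ = ∫ y in Ω, h y := by
      refine integral_congr_ae ?_
      filter_upwards [hw] with y hy
      rw [hy, Real.norm_of_nonneg h.nonneg]
    rw [h1]
    exact setIntegral_eq_integral_of_forall_compl_eq_zero fun y hy =>
      image_eq_zero_of_notMem_tsupport fun hm => hy (hsub hm)
  -- Testing with the radial field gives `‖w‖ ≤ r * v` for the variation `v` of `w`, because `d ≥
  -- 1`. Rescaling by `c / v` then yields variation `c` and norm at most `c * r`.
  have hlow : ENNReal.ofReal (r⁻¹ * ‖w‖) ≤ variation w (Metric.ball x r) := by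
    obtain ⟨ξ, hξ, hdiv⟩ := exists_radial_testField x hr
    refine le_trans (ENNReal.ofReal_le_ofReal ?_) (ofReal_integral_le_variation w hξ)
    rw [integral_mul_divergence_eq hsub hw]
    have h1 : ∀ y, h y * divergence ξ y = h y * (r⁻¹ * d) := fun y => by
      by_cases hy : y ∈ Metric.ball x (r / 2)
      · rw [hdiv y hy]
      · have : h y = 0 := h.zero_of_le_dist (by simpa using hy)
        rw [this, zero_mul, zero_mul]
    simp only [h1]
    rw [integral_mul_const, ← hnorm, mul_comm]
    have : (1 : ℝ) ≤ d := by exact_mod_cast hd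
    have h2 : 0 ≤ r⁻¹ := by positivity
    exact mul_le_mul_of_nonneg_left (le_mul_of_one_le_right h2 this) (norm_nonneg _)
  have hfin : variation w (Metric.ball x r) ≠ ∞ := ((variation_mono w hball).trans_lt hBV).ne
  set v : ℝ := (variation w (Metric.ball x r)).toReal with hv
  have hlow' : r⁻¹ * ‖w‖ ≤ v := (ENNReal.ofReal_le_iff_le_toReal hfin).1 hlow
  have hw0 : 0 < ‖w‖ := hnorm ▸ hI
  have hv0 : 0 < v := lt_of_lt_of_le (by positivity) hlow'
  have hcv : 0 ≤ c / v := by positivity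
  refine ⟨(c / v) • w, ?_, ?_, ?_, ?_⟩
  · change variation _ _ < ∞
    rw [variation_smul hcv]
    exact ENNReal.mul_lt_top ENNReal.ofReal_lt_top hBV
  · filter_upwards [hw, Lp.coeFn_smul (c / v) w] with y h1 h2 hy
    rw [h2, Pi.smul_apply, h1, h.zero_of_le_dist, smul_zero]
    simpa using (not_le.1 hy).le
  · rw [variation_smul hcv, ← ENNReal.ofReal_toReal hfin, ← ENNReal.ofReal_mul hcv,
      div_mul_cancel₀ c hv0.ne']
  · rw [norm_smul, Real.norm_of_nonneg hcv, div_mul_eq_mul_div, div_le_iff₀ hv0, mul_assoc]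
    refine mul_le_mul_of_nonneg_left ?_ hc
    rwa [inv_mul_le_iff₀ hr] at hlow'

/-! ### Perturbation in a tiny ball. -/

lemma IsBV.add {d : ℕ} {Ω : Set (Euc d)} {φ ψ : LOne Ω} (hφ : IsBV φ) (hψ : IsBV ψ) :
    IsBV (φ + ψ) :=
  (variation_add_le_add φ ψ Ω).trans_lt (ENNReal.add_lt_top.2 ⟨hφ, hψ⟩)

lemma Measure.ext_of_forall_isOpen {X : Type*} [TopologicalSpace X] [MeasurableSpace X]
    [BorelSpace X] {μ ν : Measure X} [IsFiniteMeasure μ] (h : ∀ U, IsOpen U → μ U = ν U) :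
    μ = ν :=
  ext_of_generate_finite {U : Set X | IsOpen U} BorelSpace.measurable_eq isPiSystem_isOpen h
    (h univ isOpen_univ)

lemma totalVariationMeasure_restrict_congr {d : ℕ} {Ω K : Set (Euc d)} (hΩ : IsOpen Ω)
    (hK : IsClosed K) {φ ψ : LOne Ω} (hφ : IsBV φ)
    (h : ∀ᵐ x ∂(volume.restrict Ω), x ∉ K → φ x = ψ x) :
    (totalVariationMeasure φ).restrict Kᶜ = (totalVariationMeasure ψ).restrict Kᶜ := by
  have := hφ.isFiniteMeasure hΩ
  refine Measure.ext_of_forall_isOpen fun U hU => ?_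
  rw [Measure.restrict_apply hU.measurableSet, Measure.restrict_apply hU.measurableSet,
    totalVariationMeasure_apply_open hΩ _ (hU.inter hK.isOpen_compl),
    totalVariationMeasure_apply_open hΩ _ (hU.inter hK.isOpen_compl)]
  refine variation_congr ?_
  filter_upwards [h] with x hx hxU
  exact hx hxU.1.2

/-- A finite measure has countably many atoms, and countable sets have dense complement when `d ≥
1`. So `O` contains a non-atom, around which outer regularity gives small balls of small measure. -/
lemma exists_ball_measure_le {d : ℕ} (hd : 1 ≤ d) (μ : Measure (Euc d)) [IsFiniteMeasure μ]
    {O : Set (Euc d)} (hO : IsOpen O) (hne : O.Nonempty) {ε : ℝ≥0∞} (hε : 0 < ε) {R : ℝ}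
    (hR : 0 < R) :
    ∃ x r, 0 < r ∧ r ≤ R ∧ Metric.ball x r ⊆ O ∧ μ (Metric.ball x r) ≤ ε := by
  have : Nonempty (Fin d) := ⟨⟨0, hd⟩⟩
  have hcount : {x : Euc d | 0 < μ {x}}.Countable :=
    Measure.countable_meas_pos_of_disjoint_iUnion (fun x => measurableSet_singleton x)
      fun x y hxy => by simpa using hxy
  obtain ⟨x, hx, hxO⟩ := (hcount.dense_compl ℝ).exists_mem_open hO hne
  have hx0 : μ {x} < ε := by
    have : μ {x} = 0 := by simpa using hx
    rwa [this]
  obtain ⟨V, hxV, hV, hμV⟩ := Set.exists_isOpen_lt_of_lt {x} ε hx0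
  obtain ⟨r, hr, hball⟩ := Metric.isOpen_iff.1 (hO.inter hV) x ⟨hxO, hxV rfl⟩
  have hb : Metric.ball x (min r R) ⊆ O ∩ V :=
    (Metric.ball_subset_ball (min_le_left _ _)).trans hball
  exact ⟨x, min r R, lt_min hr hR, min_le_right _ _, hb.trans inter_subset_left,
    (measure_mono (hb.trans inter_subset_right)).trans hμV.le⟩

/-- A function of bounded variation can be perturbed in a tiny ball, where it has little variation,
so as to produce there a prescribed amount of variation. -/
lemma exists_concentrated_perturbation {d : ℕ} (hd : 1 ≤ d) {Ω : Set (Euc d)} (hΩ : IsOpen Ω)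
    {φ : LOne Ω} (hφ : IsBV φ) {O : Set (Euc d)} (hO : IsOpen O) (hne : O.Nonempty) (hOΩ : O ⊆ Ω)
    {c ε : ℝ} (hc : 0 ≤ c) (hε : 0 < ε) :
    ∃ ψ : LOne Ω, IsBV ψ ∧ ‖ψ - φ‖ ≤ ε ∧ ∃ B ⊆ O, IsOpen B ∧
      (∀ᵐ x ∂(volume.restrict Ω), x ∉ B → ψ x = φ x) ∧
      (totalVariationMeasure ψ).restrict Bᶜ = (totalVariationMeasure φ).restrict Bᶜ ∧
      totalVariationMeasure φ B ≤ ENNReal.ofReal ε ∧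
      totalVariationMeasure ψ B ≤ totalVariationMeasure φ B + ENNReal.ofReal c ∧
      ENNReal.ofReal c ≤ totalVariationMeasure ψ B + totalVariationMeasure φ B := by
  have := hφ.isFiniteMeasure hΩ
  -- With `r ≤ ε / (c + 1)` the bump has norm at most `c * r ≤ ε`; the `+ 1` covers `c = 0`.
  obtain ⟨x, r, hr, hrR, hBO, hμB⟩ := exists_ball_measure_le hd (totalVariationMeasure φ) hO hne
    (ENNReal.ofReal_pos.2 hε) (R := ε / (c + 1)) (by positivity)
  obtain ⟨w, hwBV, hw0, hwc, hwn⟩ := exists_bump hd hr (hBO.trans hOΩ) hc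
  have hKB : Metric.closedBall x (r / 2) ⊆ Metric.ball x r :=
    Metric.closedBall_subset_ball (by linarith)
  have hTV : ∀ ζ : LOne Ω, totalVariationMeasure ζ (Metric.ball x r)
      = variation ζ (Metric.ball x r) := fun ζ => by
    rw [totalVariationMeasure_apply_open hΩ ζ Metric.isOpen_ball,
      inter_eq_left.2 (hBO.trans hOΩ)]
  have heq : ∀ᵐ y ∂(volume.restrict Ω), y ∉ Metric.closedBall x (r / 2) → (φ + w) y = φ y := by
    filter_upwards [hw0, Lp.coeFn_add φ w] with y h1 h2 hy
    rw [h2, Pi.add_apply, h1 hy, add_zero]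
  refine ⟨φ + w, hφ.add hwBV, ?_, Metric.ball x r, hBO, Metric.isOpen_ball, ?_, ?_, hμB, ?_, ?_⟩
  · rw [add_sub_cancel_left]
    refine hwn.trans ((mul_le_mul_of_nonneg_left hrR hc).trans ?_)
    rw [mul_div_assoc', div_le_iff₀ (by positivity)]
    nlinarith
  · filter_upwards [heq] with y hy hyB
    exact hy fun h => hyB (hKB h)
  -- The complement of the open ball is not open, so the comparison is made off the smaller closed
  -- ball and then restricted. Hence the two measures also agree on the bounding sphere.
  · have h1 := totalVariationMeasure_restrict_congr hΩ Metric.isClosed_closedBall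
      (hφ.add hwBV) heq
    have h2 : (Metric.ball x r)ᶜ ⊆ (Metric.closedBall x (r / 2))ᶜ := compl_subset_compl.2 hKB
    rw [← Measure.restrict_restrict_of_subset h2, h1, Measure.restrict_restrict_of_subset h2]
  · rw [hTV, hTV, ← hwc]
    exact variation_add_le_add φ w _
  · rw [hTV, hTV, ← hwc]
    calc variation w (Metric.ball x r) = variation ((φ + w) + -φ) (Metric.ball x r) := by
          rw [add_neg_cancel_comm]
      _ ≤ variation (φ + w) (Metric.ball x r) + variation (-φ) (Metric.ball x r) :=
          variation_add_le_add _ _ _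
      _ ≤ _ := by gcongr; exact variation_neg_le φ _

/-! ### The weighted measure, its domain, and nondegeneracy. -/

/-- The measure `ρ² |Dφ|`. -/
def weightedTVMeasure {d : ℕ} {Ω : Set (Euc d)} (ρ : Euc d → ℝ) (φ : LOne Ω) :
    Measure (Euc d) :=
  (totalVariationMeasure φ).withDensity fun x => ENNReal.ofReal (ρ x ^ 2)

lemma isEnergyMeasure_weightedTVMeasure {d : ℕ} {Ω : Set (Euc d)} (hΩ : IsOpen Ω) (ρ : Euc d → ℝ)
    (φ : LOne Ω) : IsEnergyMeasure Ω (weightedTV Ω ρ) φ (weightedTVMeasure ρ φ) where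
  compl_eq_zero :=
    withDensity_absolutelyContinuous _ _ (totalVariationMeasure_compl hΩ φ)
  apply_open _ hA _ := withDensity_apply _ hA.measurableSet

lemma IsEnergyMeasure.unique {d : ℕ} {Ω : Set (Euc d)} (hΩ : IsOpen Ω)
    {F : LOne Ω → Set (Euc d) → ℝ≥0∞} {φ : LOne Ω} (hφ : φ ∈ energyDomain Ω F)
    {μ ν : Measure (Euc d)} (hμ : IsEnergyMeasure Ω F φ μ) (hν : IsEnergyMeasure Ω F φ ν) :
    μ = ν := by
  have hinter : ∀ (κ : Measure (Euc d)), IsEnergyMeasure Ω F φ κ → ∀ U, IsOpen U →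
      κ U = F φ (U ∩ Ω) := fun κ hκ U hU => by
    rw [← hκ.apply_open _ (hU.inter hΩ) inter_subset_right]
    exact (measure_inter_conull hκ.compl_eq_zero).symm
  have : IsFiniteMeasure μ := ⟨by
    rw [hinter μ hμ univ isOpen_univ, univ_inter]
    exact hφ⟩
  exact Measure.ext_of_forall_isOpen fun U hU => by rw [hinter μ hμ U hU, hinter ν hν U hU]

lemma exists_sq_bounds {d : ℕ} {Ω : Set (Euc d)} (hΩb : Bornology.IsBounded Ω) {ρ : Euc d → ℝ}
    (hρ₀ : ContinuousOn ρ (closure Ω)) (hρpos : ∀ x ∈ closure Ω, 0 < ρ x) :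
    ∃ m M : ℝ, 0 < m ∧ 0 < M ∧ ∀ x ∈ closure Ω, m ≤ ρ x ^ 2 ∧ ρ x ^ 2 ≤ M := by
  rcases (closure Ω).eq_empty_or_nonempty with h | h
  · exact ⟨1, 1, one_pos, one_pos, by simp [h]⟩
  have hc : IsCompact (closure Ω) := hΩb.isCompact_closure
  obtain ⟨a, ha, hmin⟩ := hc.exists_isMinOn h (hρ₀.pow 2)
  obtain ⟨b, hb, hmax⟩ := hc.exists_isMaxOn h (hρ₀.pow 2)
  exact ⟨ρ a ^ 2, ρ b ^ 2, pow_pos (hρpos a ha) 2, pow_pos (hρpos b hb) 2,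
    fun x hx => ⟨hmin hx, hmax hx⟩⟩

lemma weightedTVMeasure_apply_le {d : ℕ} {Ω : Set (Euc d)} (hΩ : IsOpen Ω) {ρ : Euc d → ℝ}
    {M : ℝ} (hM : ∀ x ∈ Ω, ρ x ^ 2 ≤ M) (φ : LOne Ω) {S : Set (Euc d)} (hS : MeasurableSet S) :
    weightedTVMeasure ρ φ S ≤ ENNReal.ofReal M * totalVariationMeasure φ S := by
  rw [weightedTVMeasure, withDensity_apply _ hS, ← setLIntegral_const]
  refine lintegral_mono_ae (ae_restrict_of_ae ?_)
  filter_upwards [compl_mem_ae_iff.2 (totalVariationMeasure_compl hΩ φ)] with x hx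
  exact ENNReal.ofReal_le_ofReal (hM x (not_not.1 hx))

lemma le_weightedTVMeasure_apply {d : ℕ} {Ω : Set (Euc d)} (hΩ : IsOpen Ω) {ρ : Euc d → ℝ}
    {m : ℝ} (hm : ∀ x ∈ Ω, m ≤ ρ x ^ 2) (φ : LOne Ω) {S : Set (Euc d)} (hS : MeasurableSet S) :
    ENNReal.ofReal m * totalVariationMeasure φ S ≤ weightedTVMeasure ρ φ S := by
  rw [weightedTVMeasure, withDensity_apply _ hS, ← setLIntegral_const]
  refine lintegral_mono_ae (ae_restrict_of_ae ?_)
  filter_upwards [compl_mem_ae_iff.2 (totalVariationMeasure_compl hΩ φ)] with x hx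
  exact ENNReal.ofReal_le_ofReal (hm x (not_not.1 hx))

lemma energyDomain_weightedTV {d : ℕ} {Ω : Set (Euc d)} (hΩ : IsOpen Ω)
    (hΩb : Bornology.IsBounded Ω) {ρ : Euc d → ℝ} (hρ₀ : ContinuousOn ρ (closure Ω))
    (hρpos : ∀ x ∈ closure Ω, 0 < ρ x) :
    energyDomain Ω (weightedTV Ω ρ) = {φ : LOne Ω | IsBV φ} := by
  obtain ⟨m, M, hm, hM, hmM⟩ := exists_sq_bounds hΩb hρ₀ hρpos
  ext φ
  change weightedTV Ω ρ φ Ω < ∞ ↔ variation φ Ω < ∞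
  rw [← (isEnergyMeasure_weightedTVMeasure hΩ ρ φ).apply_open Ω hΩ Subset.rfl]
  have h : totalVariationMeasure φ Ω = variation φ Ω := by
    rw [totalVariationMeasure_apply_open hΩ φ hΩ, inter_self]
  rw [← h]
  have h1 := weightedTVMeasure_apply_le hΩ (fun x hx => (hmM x (subset_closure hx)).2) φ
    hΩ.measurableSet
  have h2 := le_weightedTVMeasure_apply hΩ (fun x hx => (hmM x (subset_closure hx)).1) φ
    hΩ.measurableSet
  refine ⟨fun hlt => ?_, fun hlt => h1.trans_lt (ENNReal.mul_lt_top ENNReal.ofReal_lt_top hlt)⟩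
  exact ENNReal.lt_top_of_mul_ne_top_right (h2.trans_lt hlt).ne (ENNReal.ofReal_pos.2 hm).ne'

/-- `|Dφ|` vanishes on `A` because `ρ² ≥ m > 0`. One bump in a ball `B ⊆ U` therefore carries all
the variation of `ψ` in `A`, and `frontier U ⊆ A \ B` is null. -/
lemma weightedTV_nondegenerate {d : ℕ} (hd : 1 ≤ d) {Ω : Set (Euc d)} (hΩ : IsOpen Ω)
    {ρ : Euc d → ℝ} {m M : ℝ} (hm : 0 < m) (hM : 0 < M)
    (hmM : ∀ x ∈ Ω, m ≤ ρ x ^ 2 ∧ ρ x ^ 2 ≤ M) {φ : LOne Ω} (hφ : IsBV φ) {A : Set (Euc d)}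
    (hA : IsOpen A) (hAΩ : A ⊆ Ω) (h0 : weightedTV Ω ρ φ A = 0) {U : Set (Euc d)} (hU : IsOpen U)
    (hne : U.Nonempty) (hUA : closure U ⊆ A) {ε : ℝ} (hε : 0 < ε) :
    ∃ ψ : LOne Ω, IsBV ψ ∧
      (∀ᵐ x ∂(volume.restrict (Ω \ U)), ψ x = φ x) ∧ ‖ψ - φ‖ ≤ ε ∧
      weightedTVMeasure ρ ψ (frontier U) = 0 ∧ 0 < weightedTVMeasure ρ ψ A ∧
      weightedTVMeasure ρ ψ A = weightedTVMeasure ρ ψ U ∧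
      weightedTVMeasure ρ ψ U < ENNReal.ofReal ε := by
  have hUA' : U ⊆ A := subset_closure.trans hUA
  have hle := fun x hx => (hmM x hx).2
  have hge := fun x hx => (hmM x hx).1
  have hφA : totalVariationMeasure φ A = 0 := by
    have h1 := le_weightedTVMeasure_apply hΩ hge φ hA.measurableSet
    rw [(isEnergyMeasure_weightedTVMeasure hΩ ρ φ).apply_open A hA hAΩ, h0, nonpos_iff_eq_zero,
      mul_eq_zero] at h1
    exact h1.resolve_left (ENNReal.ofReal_pos.2 hm).ne'
  -- The weighted mass will be at most `M * c = ε / 2`.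
  obtain ⟨ψ, hψ, hn, B, hBU, hB, hae, hres, -, hup, hlow⟩ := exists_concentrated_perturbation hd hΩ
    hφ hU hne (hUA'.trans hAΩ) (c := ε / (2 * M)) (by positivity) hε
  have hφB : totalVariationMeasure φ B = 0 := measure_mono_null (hBU.trans hUA') hφA
  rw [hφB, zero_add] at hup
  rw [hφB, add_zero] at hlow
  have hoff : weightedTVMeasure ρ ψ (A \ B) = 0 := by
    refine withDensity_absolutelyContinuous _ _ ?_
    rw [sdiff_eq, ← Measure.restrict_apply hA.measurableSet, hres,
      Measure.restrict_apply hA.measurableSet]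
    exact measure_mono_null inter_subset_left hφA
  have hAB : weightedTVMeasure ρ ψ A = weightedTVMeasure ρ ψ B :=
    (measure_eq_measure_of_null_sdiff (hBU.trans hUA') hoff).symm
  have hUB : weightedTVMeasure ρ ψ U = weightedTVMeasure ρ ψ B :=
    (measure_eq_measure_of_null_sdiff hBU (measure_mono_null (sdiff_subset_sdiff_left hUA')
      hoff)).symm
  refine ⟨ψ, hψ, ?_, hn, ?_, ?_, hAB.trans hUB.symm, ?_⟩
  · have h1 : volume.restrict (Ω \ U) = (volume.restrict Ω).restrict Uᶜ := by
      rw [Measure.restrict_restrict hU.measurableSet.compl, sdiff_eq, inter_comm]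
    rw [h1, ae_restrict_iff' hU.measurableSet.compl]
    filter_upwards [hae] with x hx hxU
    exact hx fun h => hxU (hBU h)
  · refine measure_mono_null ?_ hoff
    rw [hU.frontier_eq]
    exact fun x hx => ⟨hUA hx.1, fun h => hx.2 (hBU h)⟩
  · rw [hAB]
    refine lt_of_lt_of_le ?_ (le_weightedTVMeasure_apply hΩ hge ψ hB.measurableSet)
    exact ENNReal.mul_pos (ENNReal.ofReal_pos.2 hm).ne'
      (lt_of_lt_of_le (ENNReal.ofReal_pos.2 (by positivity)) hlow).ne'
  · rw [hUB]
    refine (weightedTVMeasure_apply_le hΩ hle ψ hB.measurableSet).trans_lt ?_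
    refine lt_of_le_of_lt (mul_le_mul_right hup _) ?_
    rw [← ENNReal.ofReal_mul hM.le, ENNReal.ofReal_lt_ofReal_iff hε]
    rw [mul_div_assoc', div_lt_iff₀ (by positivity)]
    nlinarith [mul_pos hM hε]

/-! ### Weak* approximation of `|Dφ| + ν`. -/

/-- Off `B` the integrals cancel. On `B` there are three errors: the oscillation of `g`, the defect
`|μ B - c| ≤ ε`, and the old mass `ν B ≤ ε`. -/
lemma abs_integral_sub_integral_sub_le {X : Type*} [MeasurableSpace X] {μ ν : Measure X}
    [IsFiniteMeasure μ] [IsFiniteMeasure ν] {B : Set X} (hB : MeasurableSet B)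
    (hres : μ.restrict Bᶜ = ν.restrict Bᶜ) {c ε : ℝ} (hup : μ.real B ≤ c + ε)
    (hlow : c ≤ μ.real B + ε) (hν : ν.real B ≤ ε) {g : X → ℝ} (hg : Measurable g) {M η : ℝ}
    (hM0 : 0 ≤ M) (hη : 0 ≤ η) (hM : ∀ x, |g x| ≤ M) {y : X} (hosc : ∀ x ∈ B, |g x - g y| ≤ η) :
    |∫ x, g x ∂μ - ∫ x, g x ∂ν - c * g y| ≤ η * (c + ε) + 2 * (M * ε) := by
  have hint : ∀ (κ : Measure X) [IsFiniteMeasure κ], Integrable g κ := fun κ _ =>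
    Integrable.of_bound hg.aestronglyMeasurable M (Eventually.of_forall hM)
  rw [← integral_add_compl hB (hint μ), ← integral_add_compl hB (hint ν), hres]
  have h1 : ∫ x in B, g x ∂μ = ∫ x in B, (g x - g y) ∂μ + μ.real B * g y := by
    rw [integral_sub (hint μ).integrableOn (integrable_const _), setIntegral_const, smul_eq_mul]
    ring
  have h2 : |∫ x in B, (g x - g y) ∂μ| ≤ η * μ.real B := by
    rw [← Real.norm_eq_abs]
    exact norm_setIntegral_le_of_norm_le_const (measure_lt_top _ _) hosc
  have h3 : |∫ x in B, g x ∂ν| ≤ M * ν.real B := by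
    rw [← Real.norm_eq_abs]
    exact norm_setIntegral_le_of_norm_le_const (measure_lt_top _ _) fun x _ => hM x
  have h4 : |(μ.real B - c) * g y| ≤ ε * M := by
    rw [abs_mul]
    have : |μ.real B - c| ≤ ε := abs_le.2 ⟨by linarith, by linarith⟩
    exact mul_le_mul this (hM y) (abs_nonneg _) ((abs_nonneg _).trans this)
  have h5 : η * μ.real B ≤ η * (c + ε) := mul_le_mul_of_nonneg_left hup hη
  have h6 : M * ν.real B ≤ M * ε := mul_le_mul_of_nonneg_left hν hM0
  rw [h1]
  have h7 : ∀ I J K : ℝ, I + μ.real B * g y + K - (J + K) - c * g y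
      = I + (μ.real B - c) * g y - J := fun _ _ _ => by ring
  rw [h7]
  refine (abs_sub _ _).trans ((add_le_add (abs_add_le _ _) le_rfl).trans ?_)
  linarith

/-- Induction on the centres: the ball at `y` receives one bump of variation `ν (ball y δ)`, and the
rest of `ν`, restricted to the complement of that ball, is left to the other centres. This is why
`ν` and `ε` are quantified inside the induction. The factor `2` arises because the oscillation of
`g` is paid once for `|Dψ|` and once for `ν`, each compared with a point mass at `y`. -/
lemma exists_perturbation_of_cover {d : ℕ} (hd : 1 ≤ d) {Ω : Set (Euc d)} (hΩ : IsOpen Ω)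
    {φ : LOne Ω} (hφ : IsBV φ) {δ : ℝ} (hδ : 0 < δ) {t : Set (Euc d)} (ht : t.Finite) :
    t ⊆ Ω → ∀ (ν : Measure (Euc d)) [IsFiniteMeasure ν], ν (⋃ y ∈ t, Metric.ball y δ)ᶜ = 0 →
      ∀ ε : ℝ, 0 < ε → ∃ ψ : LOne Ω, IsBV ψ ∧ ‖ψ - φ‖ ≤ ε ∧
        ∀ (g : Euc d → ℝ) (M η : ℝ), Continuous g → 0 ≤ M → 0 ≤ η → (∀ x, |g x| ≤ M) →
          (∀ x y, dist x y < δ → |g x - g y| ≤ η) →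
          |∫ x, g x ∂(totalVariationMeasure ψ) - ∫ x, g x ∂(totalVariationMeasure φ)
            - ∫ x, g x ∂ν| ≤ η * (2 * ν.real univ + ε) + M * ε := by
  induction t, ht using Set.Finite.induction_on with
  | empty =>
    intro _ ν _ hν ε hε
    have hν0 : ν = 0 := by simpa using hν
    refine ⟨φ, hφ, by simpa using hε.le, fun g M η _ hM hη _ _ => ?_⟩
    subst hν0
    simp only [sub_self, integral_zero_measure, abs_zero]
    positivity
  | @insert y s _ _ ih =>
    intro hsΩ ν _ hν ε hε
    have hyΩ : y ∈ Ω := hsΩ (mem_insert _ _)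
    have hbm : MeasurableSet (Metric.ball y δ) := Metric.isOpen_ball.measurableSet
    obtain ⟨φ', hφ', hn', hest'⟩ := ih ((subset_insert _ _).trans hsΩ)
      (ν.restrict (Metric.ball y δ)ᶜ) (by
        rw [Measure.restrict_apply' hbm.compl]
        refine measure_mono_null (fun x hx => ?_) hν
        rw [biUnion_insert, compl_union]
        exact ⟨hx.2, hx.1⟩) (ε / 3) (by positivity)
    -- The perturbation starts from `φ'`, which already contains the other bumps, so the tiny balls
    -- need not be disjoint. This step costs `2 * M * (ε / 3)` and the induction hypothesis `M * (ε
    -- / 3)`.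
    obtain ⟨ψ, hψ, hn, B, hBO, hB, -, hres, hsmall, hup, hlow⟩ :=
      exists_concentrated_perturbation hd hΩ hφ' (Metric.isOpen_ball.inter hΩ)
        ⟨y, Metric.mem_ball_self hδ, hyΩ⟩ inter_subset_right
        (c := ν.real (Metric.ball y δ)) measureReal_nonneg (ε := ε / 3) (by positivity)
    refine ⟨ψ, hψ, ?_, fun g M η hg hM0 hη hM hosc => ?_⟩
    · calc ‖ψ - φ‖ ≤ ‖ψ - φ'‖ + ‖φ' - φ‖ := norm_sub_le_norm_sub_add_norm_sub _ _ _
        _ ≤ ε := by linarith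
    have := hψ.isFiniteMeasure hΩ
    have := hφ'.isFiniteMeasure hΩ
    have hc0 : 0 ≤ ν.real (Metric.ball y δ) := measureReal_nonneg
    have hsmall' : (totalVariationMeasure φ').real B ≤ ε / 3 :=
      ENNReal.toReal_le_of_le_ofReal (by positivity) hsmall
    have hup' : (totalVariationMeasure ψ).real B ≤ ν.real (Metric.ball y δ) + ε / 3 := by
      refine ENNReal.toReal_le_of_le_ofReal (by positivity) ?_
      rw [add_comm, ENNReal.ofReal_add (by positivity) hc0]
      exact hup.trans (by gcongr)
    have hlow' : ν.real (Metric.ball y δ) ≤ (totalVariationMeasure ψ).real B + ε / 3 := by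
      rw [← ENNReal.ofReal_le_ofReal_iff (by positivity), ENNReal.ofReal_add (by positivity)
        (by positivity), ofReal_measureReal (measure_ne_top _ B)]
      exact hlow.trans (by gcongr)
    have h1 := abs_integral_sub_integral_sub_le hB.measurableSet hres hup' hlow' hsmall'
      hg.measurable hM0 hη hM (y := y) fun x hx => hosc x y (hBO hx).1
    have h2 := hest' g M η hg hM0 hη hM hosc
    have hgν : Integrable g ν :=
      Integrable.of_bound hg.aestronglyMeasurable M (Eventually.of_forall hM)
    have h3 : |∫ x in Metric.ball y δ, g x ∂ν - ν.real (Metric.ball y δ) * g y|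
        ≤ η * ν.real (Metric.ball y δ) := by
      rw [← smul_eq_mul (ν.real _), ← setIntegral_const, ← integral_sub hgν.integrableOn
        (integrable_const _), ← Real.norm_eq_abs]
      exact norm_setIntegral_le_of_norm_le_const (measure_lt_top _ _) fun x hx => hosc x y hx
    have h4 := integral_add_compl hbm hgν
    have h5 : (ν.restrict (Metric.ball y δ)ᶜ).real univ + ν.real (Metric.ball y δ)
        = ν.real univ := by
      rw [measureReal_restrict_apply MeasurableSet.univ, univ_inter, add_comm]
      exact measureReal_add_measureReal_compl hbm
    rw [← h4, ← h5]
    rw [abs_le] at h1 h2 h3 ⊢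
    have h6 : 0 ≤ η * ε := by positivity
    constructor <;> nlinarith

/-- For `φ` of bounded variation and a finite measure `ν` on `Ω` there are `φ_n → φ` in `L¹` such
that `|Dφ_n|` converges weakly* to `|Dφ| + ν`. -/
lemma exists_seq_totalVariation_tendsto_add {d : ℕ} (hd : 1 ≤ d) {Ω : Set (Euc d)} (hΩ : IsOpen Ω)
    (hΩb : Bornology.IsBounded Ω) {φ : LOne Ω} (hφ : IsBV φ) (ν : Measure (Euc d))
    [IsFiniteMeasure ν] (hν : ν Ωᶜ = 0) :
    ∃ φs : ℕ → LOne Ω, (∀ n, IsBV (φs n)) ∧ Tendsto φs atTop (𝓝 φ) ∧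
      ∀ g : Euc d → ℝ, Continuous g → (∀ x ∉ Ω, g x = 0) →
        Tendsto (fun n => ∫ x, g x ∂(totalVariationMeasure (φs n))) atTop
          (𝓝 (∫ x, g x ∂(totalVariationMeasure φ) + ∫ x, g x ∂ν)) := by
  have hpos : ∀ n : ℕ, (0 : ℝ) < 1 / ((n : ℝ) + 1) := fun n => by positivity
  have hstep : ∀ n : ℕ, ∃ ψ : LOne Ω, IsBV ψ ∧ ‖ψ - φ‖ ≤ 1 / ((n : ℝ) + 1) ∧
      ∀ (g : Euc d → ℝ) (M η : ℝ), Continuous g → 0 ≤ M → 0 ≤ η → (∀ x, |g x| ≤ M) →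
        (∀ x y, dist x y < 1 / ((n : ℝ) + 1) → |g x - g y| ≤ η) →
        |∫ x, g x ∂(totalVariationMeasure ψ) - ∫ x, g x ∂(totalVariationMeasure φ)
          - ∫ x, g x ∂ν| ≤ η * (2 * ν.real univ + 1 / ((n : ℝ) + 1)) + M * (1 / ((n : ℝ) + 1)) := by
    intro n
    obtain ⟨t, htΩ, htf, hcov⟩ := Metric.finite_approx_of_totallyBounded
      (hΩb.isCompact_closure.totallyBounded.subset subset_closure) _ (hpos n)
    exact exists_perturbation_of_cover hd hΩ hφ (hpos n) htf htΩ ν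
      (measure_mono_null (compl_subset_compl.2 hcov) hν) _ (hpos n)
  choose φs hBV hn hest using hstep
  have h0 : Tendsto (fun n : ℕ => 1 / ((n : ℝ) + 1)) atTop (𝓝 0) :=
    tendsto_one_div_add_atTop_nhds_zero_nat
  refine ⟨φs, hBV, ?_, fun g hg hgΩ => ?_⟩
  · rw [tendsto_iff_norm_sub_tendsto_zero]
    exact squeeze_zero (fun n => norm_nonneg _) hn h0
  -- Compact support makes `g` bounded and uniformly continuous, as the estimate requires.
  have hgs : HasCompactSupport g :=
    HasCompactSupport.intro hΩb.isCompact_closure fun x hx => hgΩ x fun h => hx (subset_closure h)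
  obtain ⟨M, hM⟩ := hgs.exists_bound_of_continuous hg
  have hM0 : 0 ≤ M := (norm_nonneg _).trans (hM 0)
  have huc := Metric.uniformContinuous_iff.1 (hgs.uniformContinuous_of_continuous hg)
  rw [Metric.tendsto_atTop']
  intro κ hκ
  -- This `η`, and the bound `κ / (4 * (M + 1))` on the mesh below, make each of the two error terms
  -- at most `κ / 4`.
  set η : ℝ := κ / (4 * (2 * ν.real univ + 1)) with hη
  have hD : 0 < 2 * ν.real univ + 1 := by positivity
  have hη0 : 0 < η := by positivity
  obtain ⟨δ, hδ, hδg⟩ := huc η hη0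
  have h1 : ∀ᶠ n : ℕ in atTop, 1 / ((n : ℝ) + 1) < min δ (κ / (4 * (M + 1))) :=
    h0.eventually_lt_const (by positivity)
  obtain ⟨N, hN⟩ := eventually_atTop.1 h1
  refine ⟨N, fun n hnN => ?_⟩
  have h2 := hN n hnN.le
  have h3 := hest n g M η hg hM0 hη0.le hM fun x y hxy =>
    (hδg (hxy.trans (h2.trans_le (min_le_left _ _)))).le
  rw [Real.dist_eq, ← sub_sub]
  refine h3.trans_lt ?_
  have h4 : 1 / ((n : ℝ) + 1) ≤ 1 := by
    rw [div_le_one (by positivity)]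
    linarith [(Nat.cast_nonneg n : (0 : ℝ) ≤ n)]
  have h5 : η * (2 * ν.real univ + 1 / ((n : ℝ) + 1)) ≤ κ / 4 := by
    refine (mul_le_mul_of_nonneg_left (by linarith) hη0.le : _ ≤ η * (2 * ν.real univ + 1)).trans ?_
    rw [hη, div_mul_eq_mul_div, div_le_div_iff₀ (by positivity) (by positivity)]
    linarith
  have h6 : M * (1 / ((n : ℝ) + 1)) ≤ κ / 4 := by
    have h7 := (h2.trans_le (min_le_right _ _)).le
    refine (mul_le_mul (by linarith : M ≤ M + 1) h7 (hpos n).le (by linarith)).trans ?_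
    rw [mul_div_assoc', div_le_div_iff₀ (by positivity) (by positivity)]
    linarith
  linarith

/-! ### Pure lower semicontinuity of the weighted energy. -/

/-- Nothing is known about `w` off `Ω`; there continuity follows from `|g w| ≤ C |g|`, whose right
side tends to `0`. With `w = ρ²` it turns a test function into another one. -/
lemma continuous_mul_of_continuousOn {X : Type*} [TopologicalSpace X] {Ω : Set X} (hΩ : IsOpen Ω)
    {g w : X → ℝ} (hg : Continuous g) (hgΩ : ∀ x ∉ Ω, g x = 0) (hw : ContinuousOn w Ω) {C : ℝ}
    (hC : ∀ x ∈ Ω, |w x| ≤ C) : Continuous fun x => g x * w x := by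
  rw [continuous_iff_continuousAt]
  intro x
  by_cases hx : x ∈ Ω
  · exact hg.continuousAt.mul (hw.continuousAt (hΩ.mem_nhds hx))
  · have h0 : Tendsto (fun y => |g y| * C) (𝓝 x) (𝓝 0) := by
      have := (hg.abs.mul_const C).tendsto x
      simpa [hgΩ x hx] using this
    rw [ContinuousAt, hgΩ x hx, zero_mul]
    refine squeeze_zero_norm (fun y => ?_) h0
    rw [norm_mul, Real.norm_eq_abs, Real.norm_eq_abs]
    by_cases hy : y ∈ Ω
    · exact mul_le_mul_of_nonneg_left (hC y hy) (abs_nonneg _)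
    · simp [hgΩ y hy]

lemma aemeasurable_totalVariationMeasure {d : ℕ} {Ω : Set (Euc d)} (hΩ : IsOpen Ω)
    {w : Euc d → ℝ} (hw : ContinuousOn w Ω) (φ : LOne Ω) :
    AEMeasurable w (totalVariationMeasure φ) :=
  hw.aemeasurable hΩ.measurableSet

lemma integral_weightedTVMeasure {d : ℕ} {Ω : Set (Euc d)} (hΩ : IsOpen Ω) {ρ : Euc d → ℝ}
    (hρ : ContinuousOn ρ Ω) (φ : LOne Ω) (g : Euc d → ℝ) :
    ∫ x, g x ∂(weightedTVMeasure ρ φ) = ∫ x, g x * ρ x ^ 2 ∂(totalVariationMeasure φ) := by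
  have hw : AEMeasurable (fun x => ENNReal.ofReal (ρ x ^ 2)) (totalVariationMeasure φ) :=
    (aemeasurable_totalVariationMeasure hΩ (hρ.pow 2) φ).ennreal_ofReal
  rw [weightedTVMeasure, integral_withDensity_eq_integral_toReal_smul₀ hw
    (Eventually.of_forall fun _ => ENNReal.ofReal_lt_top)]
  refine integral_congr_ae (Eventually.of_forall fun x => ?_)
  simp only [ENNReal.toReal_ofReal (sq_nonneg (ρ x)), smul_eq_mul]
  ring

lemma isPurelyLSC_weightedTV {d : ℕ} (hd : 1 ≤ d) {Ω : Set (Euc d)} (hΩ : IsOpen Ω)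
    (hΩb : Bornology.IsBounded Ω) {ρ : Euc d → ℝ}
    (hρ₀ : ContinuousOn ρ (closure Ω)) (hρpos : ∀ x ∈ closure Ω, 0 < ρ x) :
    IsPurelyLSC Ω (weightedTV Ω ρ) := by
  obtain ⟨m, M, hm, -, hmM⟩ := exists_sq_bounds hΩb hρ₀ hρpos
  have hρ : ContinuousOn ρ Ω := hρ₀.mono subset_closure
  have hdom := energyDomain_weightedTV hΩ hΩb hρ₀ hρpos
  intro φ hφ μ hμ f hf hf1
  -- The given energy measure is arbitrary, but uniqueness identifies it with `ρ² |Dφ|`.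
  obtain rfl := hμ.unique hΩ hφ (isEnergyMeasure_weightedTVMeasure hΩ ρ φ)
  rw [hdom] at hφ
  have hφ : IsBV φ := hφ
  have hfin := hφ.isFiniteMeasure hΩ
  set τ := totalVariationMeasure φ
  have hτΩ : ∀ᵐ x ∂τ, x ∈ Ω := by
    filter_upwards [compl_mem_ae_iff.2 (totalVariationMeasure_compl hΩ φ)] with x hx
    exact not_not.1 hx
  have hw : AEMeasurable (fun x => ENNReal.ofReal (ρ x ^ 2)) τ :=
    (aemeasurable_totalVariationMeasure hΩ (hρ.pow 2) φ).ennreal_ofReal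
  have hwpos : ∀ᵐ x ∂τ, ENNReal.ofReal (ρ x ^ 2) ≠ 0 := by
    filter_upwards [hτΩ] with x hx
    exact (ENNReal.ofReal_pos.2 (pow_pos (hρpos x (subset_closure hx)) 2)).ne'
  -- Positivity of the weight lets almost everywhere statements pass back from `ρ² |Dφ|` to `|Dφ|`;
  -- the bound `ρ² ≥ m` below does the same for integrability of `f`.
  have hac : τ ≪ weightedTVMeasure ρ φ := withDensity_absolutelyContinuous' hw hwpos
  have hf1' : ∀ᵐ x ∂τ, 1 ≤ f x := hac.ae_le hf1
  have hfm : AEStronglyMeasurable f τ := hf.aestronglyMeasurable.mono_ac hac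
  have hfw : Integrable (fun x => ρ x ^ 2 * f x) τ := by
    have := (integrable_withDensity_iff_integrable_smul₀' hw
      (Eventually.of_forall fun _ => ENNReal.ofReal_lt_top)).1 hf
    simpa only [ENNReal.toReal_ofReal (sq_nonneg _), smul_eq_mul] using this
  have hfτ : Integrable f τ := by
    refine (hfw.const_mul m⁻¹).mono hfm ?_
    filter_upwards [hτΩ] with x hx
    rw [norm_mul, norm_mul, norm_inv, Real.norm_of_nonneg hm.le, Real.norm_of_nonneg (sq_nonneg _),
      ← mul_assoc]
    refine le_mul_of_one_le_left (norm_nonneg _) ?_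
    rw [inv_mul_eq_div, one_le_div hm]
    exact (hmM x (subset_closure hx)).1
  have hf1int : Integrable (fun x => f x - 1) τ := hfτ.sub (integrable_const 1)
  set ν : Measure (Euc d) := τ.withDensity fun x => ENNReal.ofReal (f x - 1) with hν
  have hνfin : IsFiniteMeasure ν := isFiniteMeasure_withDensity_ofReal hf1int.2
  have hνΩ : ν Ωᶜ = 0 := withDensity_absolutelyContinuous _ _ (totalVariationMeasure_compl hΩ φ)
  obtain ⟨φs, hBV, hlim, hconv⟩ := exists_seq_totalVariation_tendsto_add hd hΩ hΩb hφ ν hνΩ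
  refine ⟨φs, fun n => weightedTVMeasure ρ (φs n), fun n => by rw [hdom]; exact hBV n,
    fun n => isEnergyMeasure_weightedTVMeasure hΩ ρ (φs n), hlim, fun g hg hgΩ => ?_⟩
  simp only [integral_weightedTVMeasure hΩ hρ]
  have hgρ : Continuous fun x => g x * ρ x ^ 2 :=
    continuous_mul_of_continuousOn hΩ hg hgΩ (hρ.pow 2) (C := M) fun x hx => by
      rw [abs_of_nonneg (sq_nonneg _)]
      exact (hmM x (subset_closure hx)).2
  have hgρ0 : ∀ x ∉ Ω, g x * ρ x ^ 2 = 0 := fun x hx => by rw [hgΩ x hx, zero_mul]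
  have hgs : HasCompactSupport fun x => g x * ρ x ^ 2 :=
    HasCompactSupport.intro hΩb.isCompact_closure fun x hx => hgρ0 x fun h => hx (subset_closure h)
  obtain ⟨C, hC⟩ := hgs.exists_bound_of_continuous hgρ
  have hgint : Integrable (fun x => g x * ρ x ^ 2) τ :=
    Integrable.of_bound hgρ.aestronglyMeasurable C (Eventually.of_forall hC)
  -- Since `f = 1 + (f - 1)` with `f ≥ 1` almost everywhere, the target measure is `ρ² (|Dφ| + ν)`.
  have hlimit : ∫ x, g x ∂((weightedTVMeasure ρ φ).withDensity fun x => ENNReal.ofReal (f x))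
      = ∫ x, g x * ρ x ^ 2 ∂τ + ∫ x, g x * ρ x ^ 2 ∂ν := by
    rw [integral_withDensity_eq_integral_toReal_smul₀
      hf.aestronglyMeasurable.aemeasurable.ennreal_ofReal
      (Eventually.of_forall fun _ => ENNReal.ofReal_lt_top), integral_weightedTVMeasure hΩ hρ, hν,
      integral_withDensity_eq_integral_toReal_smul₀
      hf1int.aestronglyMeasurable.aemeasurable.ennreal_ofReal
      (Eventually.of_forall fun _ => ENNReal.ofReal_lt_top), ← integral_add hgint]
    · refine integral_congr_ae ?_
      filter_upwards [hf1'] with x hx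
      simp only [smul_eq_mul]
      rw [ENNReal.toReal_ofReal (by linarith), ENNReal.toReal_ofReal (by linarith)]
      ring
    · refine (hf1int.mul_bdd (c := C) hgρ.aestronglyMeasurable (Eventually.of_forall hC)).congr ?_
      filter_upwards [hf1'] with x hx
      rw [ENNReal.toReal_ofReal (by linarith), smul_eq_mul]
  rw [hlimit]
  exact hconv _ hgρ hgρ0

end

theorem mainTheorem6 (d : ℕ) (hd : 1 ≤ d) (Ω : Set (Euc d)) (hΩ : IsOpen Ω)
    (hΩb : Bornology.IsBounded Ω) (ρ : Euc d → ℝ) (hρ₁ : ContDiffOn ℝ 1 ρ Ω)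
    (hρ₀ : ContinuousOn ρ (closure Ω)) (hρpos : ∀ x ∈ closure Ω, 0 < ρ x) :
    energyDomain Ω (weightedTV Ω ρ) = {φ : LOne Ω | IsBV φ} ∧
      IsAdmissible Ω (weightedTV Ω ρ) ∧
      IsPurelyLSC Ω (weightedTV Ω ρ) := by
  have hdom := energyDomain_weightedTV hΩ hΩb hρ₀ hρpos
  have hlsc := isPurelyLSC_weightedTV hd hΩ hΩb hρ₀ hρpos
  obtain ⟨m, M, hm, hM, hmM⟩ := exists_sq_bounds hΩb hρ₀ hρpos
  refine ⟨hdom, ⟨fun A hA hAΩ => lowerSemicontinuous_weightedTV hΩ hρ₁.continuousOn hA hAΩ,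
    fun φ _ => ⟨_, isEnergyMeasure_weightedTVMeasure hΩ ρ φ⟩, ?_, hlsc⟩, hlsc⟩
  intro φ hφ A hA hAΩ h0 U hU hne _ hUA ε hε
  rw [hdom] at hφ
  obtain ⟨ψ, hψ, h⟩ := weightedTV_nondegenerate hd hΩ hm hM
    (fun x hx => hmM x (subset_closure hx)) hφ hA hAΩ h0 hU hne hUA hε
  exact ⟨ψ, by rw [hdom]; exact hψ, _, isEnergyMeasure_weightedTVMeasure hΩ ρ ψ, h⟩
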